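/- Let $\Sigma_k=\{0,\dots,k-1\}$. A factor of a (right-infinite or bi-infinite) word is a finite block of consecutive letters of it, and a square is a finite word of the form $vv$ with $v$ non-empty. Let $b_3$ be the Hall–Thue word, that is, the right-infinite fixed point starting with $0$ of the morphism $0\mapsto 012$, $1\mapsto 02$, $2\mapsto 1$ on $\Sigma_3^*$, and let $g_4:\Sigma_3^*\to\Sigma_2^*$ be the morphism defined by $$g_4(0)=00010011000111011,\qquad g_4(1)=000100111011,\qquad g_4(2)=00111.$$ Theorem. Every bi-infinite word over $\Sigma_2$ that contains no squares besides $00$, $11$, $001001$ and $110110$ has the same set of factors as the right-infinite word $g_4(b_3)$. Moreover, $g_4(b_3)$ itself contains no squares besides $00$, $11$, $001001$ and $110110$. -/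

import Mathlib

namespace FourSquares

/-- The image of a finite word under the morphism of free monoids that extends
`f : α → List β`. -/
def applyMorphism {α β : Type*} (f : α → List β) (u : List α) : List β :=
  u.flatMap f

/-- The prefix of length `n` of a right-infinite word. -/
def wordPrefix {α : Type*} (x : ℕ → α) (n : ℕ) : List α :=
  (List.range n).map x

/-- The image of the right-infinite word `x` under a non-erasing morphism `f`: its letter at
position `n` is read off from the image of the prefix of `x` of length `n + 1`, which has length at
least `n + 1`. -/
def applyInfinite {α β : Type*} [Inhabited β] (f : α → List β) (x : ℕ → α) : ℕ → β :=
  fun n => (applyMorphism f (wordPrefix x (n + 1))).getD n default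

/-- The set of (finite) factors of an infinite word: `ι = ℕ` for right-infinite words, `ι = ℤ` for
bi-infinite words. -/
def factorSet {ι α : Type*} [AddMonoidWithOne ι] (x : ι → α) : Set (List α) :=
  {u | ∃ i : ι, ∀ (k : ℕ) (hk : k < u.length), u[k] = x (i + (k : ι))}

/-- A finite word is a square if it is of the form `vv` with `v` non-empty. -/
def IsSquareWord {α : Type*} (u : List α) : Prop :=
  ∃ v : List α, v ≠ [] ∧ u = v ++ v

/-- The infinite word `x` contains no squares besides those in `S`. -/
def ContainsOnlySquares {ι α : Type*} [AddMonoidWithOne ι] (x : ι → α)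
    (S : Set (List α)) : Prop :=
  ∀ u ∈ factorSet x, IsSquareWord u → u ∈ S

/-- The morphism `0 ↦ 012`, `1 ↦ 02`, `2 ↦ 1`. -/
def hallThueMorphism : Fin 3 → List (Fin 3) :=
  ![[0, 1, 2], [0, 2], [1]]

/-- The Hall–Thue word `b₃`, the limit of the iterates on `0` of the morphism `012/02/1`. -/
def hallThue : ℕ → Fin 3 :=
  fun n => ((applyMorphism hallThueMorphism)^[n] [0]).getD n 0

/-- The morphism `g₄`. -/
def g4 : Fin 3 → List (Fin 2) :=
  ![[0, 0, 0, 1, 0, 0, 1, 1, 0, 0, 0, 1, 1, 1, 0, 1, 1],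
    [0, 0, 0, 1, 0, 0, 1, 1, 1, 0, 1, 1],
    [0, 0, 1, 1, 1]]

/-- The squares `00`, `11`, `001001`, `110110`. -/
def fourSquares : Set (List (Fin 2)) :=
  {[0, 0], [1, 1], [0, 0, 1, 0, 0, 1], [1, 1, 0, 1, 1, 0]}

end FourSquares

/-!
The morphism `hallThueMorphism` is written `f`. A word `w` is related to a word `y` with `w = g(y)`
by the structure `IsCoding`, which records where the blocks `g (y n)` start in `w`.

**Square-free bi-infinite words without `010` and `212`** (`IsThueWord`) have the factors of the
Hall–Thue word. Cutting such a word before every `0`, and before every `1` that does not follow a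
`0`, writes it as `f(y)`, and `y` is again such a word, since `f(010)` and `f(02120)` contain
squares (`IsThueWord.exists_hallThue_isCoding`). Iterating, the word is `f ^ k` applied to such a
word for every `k`; a given factor then lies in `f ^ k (ab)` for two letters `a ≠ b`, and every `ab`
occurs in the Hall–Thue word. Conversely each of these words contains the letter `0`, so
`f ^ k (0)` is a factor (`IsThueWord.factorSet_eq`).

**Bi-infinite binary words with only the four squares** are images under `g4`. There are few finite
words with only the four squares, and their enumeration up to length `31` shows that the starting
positions of the blocks of `g4` are recognized from the neighbouring letters, and that each block is
followed and preceded by another (`g4_blocks_right`, `g4_blocks_left`). Hence `w = g4(y)`, and `y`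
is square-free without `010` and `212` because of the squares that `w` must not contain
(`exists_g4_isCoding`). So `y` has the factors of the Hall–Thue word, and `w` those of its image.

**Squares in images of the Hall–Thue word.** Let `g` be `f` or `g4`. A long square in the image
contains a marker, a word that occurs only at block boundaries, so its two halves are cut into
blocks in the same way. Comparing the incomplete blocks at the two ends and in the middle yields a
square in the preimage, or a factor `0u1u0` of it, which contains `010` or `212`
(`exists_square_of_synchronized`). Short squares are excluded by inspecting the images of the
factors of length `7` (`IsMarked`). With `g = f`, whose fixed point the Hall–Thue word is, descent on
the period shows that this word is square-free (`window_hallThue_ne`); with `g = g4` it follows that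
its image has only the four squares (`containsOnlySquares_g4_hallThue`).
-/

namespace FourSquares

/-! ### Windows and factors -/

section Windows

variable {ι α β γ : Type*} [AddMonoidWithOne ι]

/-- The factor of length `n` of the infinite word `x` that starts at position `i`. -/
def window (x : ι → α) (i : ι) (n : ℕ) : List α :=
  (List.range n).map fun k : ℕ => x (i + (k : ι))

@[simp]
theorem length_window (x : ι → α) (i : ι) (n : ℕ) : (window x i n).length = n := by
  simp [window]

@[simp]
theorem getElem_window (x : ι → α) (i : ι) (n k : ℕ) (hk : k < (window x i n).length) :
    (window x i n)[k] = x (i + (k : ι)) := by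
  simp [window]

theorem getElem?_window (x : ι → α) (i : ι) {n k : ℕ} (hk : k < n) :
    (window x i n)[k]? = some (x (i + (k : ι))) := by
  rw [List.getElem?_eq_getElem (by simpa using hk), getElem_window]

theorem window_add (x : ι → α) (i : ι) (m n : ℕ) :
    window x i (m + n) = window x i m ++ window x (i + (m : ι)) n := by
  simp [window, List.range_add, add_assoc]

theorem window_one (x : ι → α) (i : ι) : window x i 1 = [x i] := by
  simp [window]

theorem window_succ (x : ι → α) (i : ι) (n : ℕ) :
    window x i (n + 1) = x i :: window x (i + 1) n := by
  rw [add_comm, window_add, window_one]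
  simp

theorem take_drop_window (x : ι → α) (i : ι) {a b n : ℕ} (h : a + b ≤ n) :
    ((window x i n).drop a).take b = window x (i + (a : ι)) b := by
  obtain ⟨k, rfl⟩ := Nat.exists_eq_add_of_le h
  rw [add_assoc, window_add, List.drop_left' (by simp), window_add, List.take_left' (by simp)]

theorem mem_factorSet_iff {x : ι → α} {u : List α} :
    u ∈ factorSet x ↔ ∃ i, window x i u.length = u := by
  constructor
  · rintro ⟨i, hi⟩
    exact ⟨i, List.ext_getElem (by simp) fun k hk hk' => by rw [getElem_window, hi k hk']⟩
  · rintro ⟨i, hi⟩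
    refine ⟨i, fun k hk => ?_⟩
    have h := getElem?_window x i hk
    rw [hi, List.getElem?_eq_getElem hk] at h
    exact Option.some.inj h

theorem window_mem_factorSet (x : ι → α) (i : ι) (n : ℕ) : window x i n ∈ factorSet x :=
  mem_factorSet_iff.2 ⟨i, by rw [length_window]⟩

theorem mem_factorSet_of_infix {x : ι → α} {u v : List α} (hu : u ∈ factorSet x)
    (h : v <:+: u) : v ∈ factorSet x := by
  obtain ⟨s, t, rfl⟩ := h
  obtain ⟨i, hi⟩ := mem_factorSet_iff.1 hu
  refine mem_factorSet_iff.2 ⟨i + (s.length : ι), ?_⟩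
  rw [← take_drop_window x i (n := (s ++ v ++ t).length) (by simp), hi]
  simp

theorem drop_take_infix (u : List α) (a b : ℕ) : (u.drop a).take b <:+: u :=
  (List.take_prefix _ _).isInfix.trans (List.drop_suffix _ _).isInfix

/-! ### Images of words under a morphism -/

theorem applyMorphism_append (g : α → List β) (u v : List α) :
    applyMorphism g (u ++ v) = applyMorphism g u ++ applyMorphism g v :=
  List.flatMap_append

@[simp]
theorem applyMorphism_singleton (g : α → List β) (a : α) : applyMorphism g [a] = g a := by
  simp [applyMorphism]

theorem applyMorphism_infix (g : α → List β) {u v : List α} (h : u <:+: v) :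
    applyMorphism g u <:+: applyMorphism g v := by
  obtain ⟨s, t, rfl⟩ := h
  exact ⟨applyMorphism g s, applyMorphism g t, by simp only [applyMorphism_append]⟩

theorem applyMorphism_prefix (g : α → List β) {u v : List α} (h : u <+: v) :
    applyMorphism g u <+: applyMorphism g v := by
  obtain ⟨t, rfl⟩ := h
  exact ⟨applyMorphism g t, by simp only [applyMorphism_append]⟩

theorem mul_length_le_length_applyMorphism {g : α → List β} {L : ℕ}
    (hg : ∀ a, L ≤ (g a).length) (u : List α) :
    L * u.length ≤ (applyMorphism g u).length := by
  induction u with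
  | nil => simp
  | cons a u ih =>
    rw [← List.singleton_append, applyMorphism_append, applyMorphism_singleton]
    have := hg a
    simp only [List.length_append, List.length_singleton]
    nlinarith

/-- The infinite word `w` is the concatenation of the blocks `g (y n)`, in this order, and the
block `g (y n)` starts at position `c n`. The field `cover` says that the blocks exhaust `w`. -/
structure IsCoding (g : α → List β) (w : ι → β) (y : ι → α) (c : ι → ι) : Prop where
  block : ∀ n, window w (c n) (g (y n)).length = g (y n)
  succ : ∀ n, c (n + 1) = c n + ((g (y n)).length : ι)
  cover : ∀ p, ∃ n, ∃ d < (g (y n)).length, p = c n + (d : ι)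

namespace IsCoding

variable {g : α → List β} {w : ι → β} {y : ι → α} {c : ι → ι}

theorem apply_add (h : IsCoding g w y c) (m : ι) (k : ℕ) :
    c (m + (k : ι)) = c m + ((applyMorphism g (window y m k)).length : ι) ∧
      window w (c m) (applyMorphism g (window y m k)).length =
        applyMorphism g (window y m k) := by
  induction k with
  | zero => simp [window, applyMorphism]
  | succ k ih =>
    obtain ⟨ih1, ih2⟩ := ih
    rw [window_add, applyMorphism_append, window_one, applyMorphism_singleton, List.length_append,
      window_add, ih2, ← ih1, h.block]
    refine ⟨?_, rfl⟩
    rw [Nat.cast_succ, ← add_assoc, h.succ, ih1, Nat.cast_add, add_assoc]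

theorem window_eq (h : IsCoding g w y c) (m : ι) {k d n : ℕ}
    (hd : d + n ≤ (applyMorphism g (window y m k)).length) :
    window w (c m + (d : ι)) n = ((applyMorphism g (window y m k)).drop d).take n := by
  rw [← (h.apply_add m k).2, take_drop_window _ _ hd]

theorem applyMorphism_mem (h : IsCoding g w y c) {u : List α} (hu : u ∈ factorSet y) :
    applyMorphism g u ∈ factorSet w := by
  obtain ⟨m, hm⟩ := mem_factorSet_iff.1 hu
  refine mem_factorSet_iff.2 ⟨c m, ?_⟩
  have := (h.apply_add m u.length).2
  rwa [hm] at this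

/-- If all blocks have length at least `L`, then a factor of length at most `k * L` is contained
in the image of `k + 1` consecutive letters. -/
theorem exists_window_infix (h : IsCoding g w y c) {L k n : ℕ} (hg : ∀ a, L ≤ (g a).length)
    (hn : n ≤ L * k) (p : ι) :
    ∃ m, window w p n <:+: applyMorphism g (window y m (k + 1)) := by
  obtain ⟨m, d, hd, rfl⟩ := h.cover p
  refine ⟨m, ?_⟩
  rw [h.window_eq m (k := k + 1)]
  · exact drop_take_infix _ _ _
  · rw [window_succ, ← List.singleton_append, applyMorphism_append, applyMorphism_singleton]
    have := mul_length_le_length_applyMorphism hg (window y (m + 1) k)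
    simp only [List.length_append, length_window] at *
    omega

theorem mem_factorSet_iff (h : IsCoding g w y c) (hg : ∀ a, 1 ≤ (g a).length) {v : List β} :
    v ∈ factorSet w ↔ ∃ u ∈ factorSet y, v <:+: applyMorphism g u := by
  constructor
  · intro hv
    obtain ⟨p, hp⟩ := FourSquares.mem_factorSet_iff.1 hv
    obtain ⟨m, hm⟩ := h.exists_window_infix hg (one_mul v.length).ge p
    exact ⟨_, window_mem_factorSet _ _ _, hp ▸ hm⟩
  · rintro ⟨u, hu, hv⟩
    exact mem_factorSet_of_infix (h.applyMorphism_mem hu) hv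

theorem comp (h : IsCoding g w y c) {f : γ → List α} {z : ι → γ} {d : ι → ι}
    (h' : IsCoding f y z d) :
    IsCoding (fun a => applyMorphism g (f a)) w z (fun n => c (d n)) where
  block n := by
    have := (h.apply_add (d n) (f (z n)).length).2
    rwa [h'.block] at this
  succ n := by
    have := (h.apply_add (d n) (f (z n)).length).1
    rwa [h'.block, ← h'.succ] at this
  cover p := by
    obtain ⟨m, e, he, rfl⟩ := h.cover p
    obtain ⟨n, k, hk, rfl⟩ := h'.cover m
    refine ⟨n, (applyMorphism g (window y (d n) k)).length + e, ?_, ?_⟩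
    · have h1 : window y (d n) (k + 1) <+: f (z n) := by
        rw [← h'.block n]
        obtain ⟨j, hj⟩ := Nat.exists_eq_add_of_lt hk
        rw [show (f (z n)).length = k + 1 + j by omega, window_add y (d n) (k + 1) j]
        exact List.prefix_append _ _
      have h2 := (applyMorphism_prefix g h1).length_le
      rw [window_add, applyMorphism_append, window_one, applyMorphism_singleton,
        List.length_append] at h2
      omega
    · rw [(h.apply_add (d n) k).1, Nat.cast_add, add_assoc]

end IsCoding

end Windows

/-! ### Enumeration of the words that satisfy a hereditary condition -/

section Words

variable {ι : Type*} [AddMonoidWithOne ι] {q : ℕ}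

/-- The words `v ++ u` with `u ∈ L` and `v` of length `n` in which every suffix longer than `u`
satisfies `ok`. -/
def extend (ok : List (Fin q) → Bool) (L : List (List (Fin q))) : ℕ → List (List (Fin q))
  | 0 => L
  | n + 1 => ((extend ok L n).flatMap fun u => (List.finRange q).map (· :: u)).filter ok

/-- The words of length `n` all of whose non-empty suffixes satisfy `ok`. -/
def words (ok : List (Fin q) → Bool) (n : ℕ) : List (List (Fin q)) :=
  extend ok [[]] n

theorem cons_mem_extend {ok : List (Fin q) → Bool} {L : List (List (Fin q))} {n : ℕ}
    {u : List (Fin q)} (hu : u ∈ extend ok L n) {a : Fin q} (ha : ok (a :: u) = true) :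
    a :: u ∈ extend ok L (n + 1) := by
  simp only [extend, List.mem_filter, List.mem_flatMap, List.mem_map, List.mem_finRange, true_and]
  exact ⟨⟨u, hu, a, rfl⟩, ha⟩

theorem window_mem_extend {ok : List (Fin q) → Bool} {L : List (List (Fin q))} {x : ι → Fin q}
    (h : ∀ u ∈ factorSet x, ok u = true) {i j : ι} {m n : ℕ} (hij : i + (n : ι) = j)
    (hL : window x j m ∈ L) : window x i (n + m) ∈ extend ok L n := by
  subst hij
  induction n generalizing i with
  | zero => simpa [extend] using hL
  | succ n ih =>
    rw [add_right_comm, window_succ]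
    refine cons_mem_extend (ih ?_) ?_
    · have h1 : (1 : ι) + (n : ι) = ((n + 1 : ℕ) : ι) := by
        rw [add_comm n 1, Nat.cast_add, Nat.cast_one]
      rwa [add_assoc, h1]
    · rw [← window_succ]
      exact h _ (window_mem_factorSet _ _ _)

theorem window_mem_words {ok : List (Fin q) → Bool} {x : ι → Fin q}
    (h : ∀ u ∈ factorSet x, ok u = true) (i : ι) (n : ℕ) : window x i n ∈ words ok n :=
  window_mem_extend h (m := 0) rfl (by simp [window])

theorem reverse_window_mem_extend {ok : List (Fin q) → Bool} {L : List (List (Fin q))}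
    {x : ι → Fin q} (h : ∀ u ∈ factorSet x, ok u.reverse = true) {i : ι} {m : ℕ}
    (hL : (window x i m).reverse ∈ L) (n : ℕ) :
    (window x i (m + n)).reverse ∈ extend ok L n := by
  induction n with
  | zero => exact hL
  | succ n ih =>
    have heq : (window x i (m + (n + 1))).reverse =
        x (i + ((m + n : ℕ) : ι)) :: (window x i (m + n)).reverse := by
      rw [← add_assoc, window_add, window_one, List.reverse_append, List.reverse_singleton,
        List.singleton_append]
    have hok := h _ (window_mem_factorSet x i (m + (n + 1)))
    rw [heq] at hok ⊢
    exact cons_mem_extend ih hok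

theorem reverse_window_mem_words {ok : List (Fin q) → Bool} {x : ι → Fin q}
    (h : ∀ u ∈ factorSet x, ok u.reverse = true) (i : ι) (n : ℕ) :
    (window x i n).reverse ∈ words ok n := by
  have := reverse_window_mem_extend h (i := i) (m := 0) (L := [[]]) (by simp [window]) n
  rwa [zero_add] at this

/-- All squares that are prefixes of `u` belong to `S`. -/
def prefixSquaresIn (S : List (List (Fin q))) (u : List (Fin q)) : Bool :=
  (List.range (u.length / 2)).all fun h =>
    !(u.take (h + 1) == (u.drop (h + 1)).take (h + 1)) || S.contains (u.take (h + 1 + (h + 1)))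

theorem prefixSquaresIn_eq_true {S : List (List (Fin q))} {u : List (Fin q)}
    (h : ∀ v ≠ [], v ++ v <+: u → v ++ v ∈ S) : prefixSquaresIn S u = true := by
  simp only [prefixSquaresIn, List.all_eq_true, List.mem_range, Bool.or_eq_true,
    Bool.not_eq_true', beq_eq_false_iff_ne, List.contains_iff_mem]
  intro k hk
  by_cases heq : u.take (k + 1) = (u.drop (k + 1)).take (k + 1)
  · have hsq : u.take (k + 1 + (k + 1)) = u.take (k + 1) ++ u.take (k + 1) := by
      rw [List.take_add, ← heq]
    rw [hsq]
    refine .inr (h _ ?_ (hsq ▸ List.take_prefix _ _))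
    intro h0
    have := congrArg List.length h0
    simp only [List.length_take, List.length_nil] at this
    omega
  · exact .inl heq

theorem prefixSquaresIn_of_mem_factorSet {S : List (List (Fin q))} {x : ι → Fin q}
    (hx : ContainsOnlySquares x {v | v ∈ S}) {u : List (Fin q)} (hu : u ∈ factorSet x) :
    prefixSquaresIn S u = true :=
  prefixSquaresIn_eq_true fun v hv h =>
    hx _ (mem_factorSet_of_infix hu h.isInfix) ⟨v, hv, rfl⟩

theorem prefixSquaresIn_reverse_of_mem_factorSet {S : List (List (Fin q))} {x : ι → Fin q}
    (hx : ContainsOnlySquares x {v | v ∈ S}) {u : List (Fin q)} (hu : u ∈ factorSet x) :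
    prefixSquaresIn (S.map List.reverse) u.reverse = true :=
  prefixSquaresIn_eq_true fun v hv h => by
    have h1 : v.reverse ++ v.reverse <:+ u := by
      rw [← List.reverse_append]
      exact List.reverse_prefix.1 (by rwa [List.reverse_reverse])
    have h2 := hx _ (mem_factorSet_of_infix hu h1.isInfix) ⟨v.reverse, by simpa using hv, rfl⟩
    exact List.mem_map.2 ⟨_, h2, by simp⟩

end Words

/-! ### Right-infinite images and the Hall–Thue word -/

theorem wordPrefix_eq_window {α : Type*} (x : ℕ → α) (n : ℕ) : wordPrefix x n = window x 0 n := by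
  simp [wordPrefix, window]

theorem window_prefix {α : Type*} (x : ℕ → α) (i : ℕ) {m n : ℕ} (h : m ≤ n) :
    window x i m <+: window x i n := by
  obtain ⟨k, rfl⟩ := Nat.exists_eq_add_of_le h
  rw [window_add]
  exact List.prefix_append _ _

theorem isCoding_applyInfinite {α β : Type*} [Inhabited β] {g : α → List β}
    (hg : ∀ a, 1 ≤ (g a).length) (x : ℕ → α) :
    IsCoding g (applyInfinite g x) x fun n => (applyMorphism g (window x 0 n)).length := by
  have hsucc : ∀ n, (applyMorphism g (window x 0 (n + 1))).length =
      (applyMorphism g (window x 0 n)).length + (g (x n)).length := fun n => by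
    rw [window_add, applyMorphism_append, List.length_append, window_one,
      applyMorphism_singleton]
    simp
  have hle : ∀ n, n ≤ (applyMorphism g (window x 0 n)).length := fun n => by
    simpa using mul_length_le_length_applyMorphism hg (window x 0 n)
  -- The letter at position `p` can be read off from the image of any sufficiently long prefix.
  have key : ∀ p n, p < (applyMorphism g (window x 0 n)).length →
      (applyMorphism g (window x 0 n))[p]? = some (applyInfinite g x p) := by
    intro p n hp
    have hp' : p < (applyMorphism g (window x 0 (p + 1))).length := hle (p + 1)
    simp only [applyInfinite, wordPrefix_eq_window, List.getD_eq_getElem?_getD,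
      List.getElem?_eq_getElem hp, List.getElem?_eq_getElem hp', Option.getD_some,
      Option.some.injEq]
    rcases le_total n (p + 1) with h | h
    · exact (applyMorphism_prefix g (window_prefix x 0 h)).getElem hp
    · exact ((applyMorphism_prefix g (window_prefix x 0 h)).getElem hp').symm
  refine ⟨fun n => ?_, hsucc, fun p => ?_⟩
  · refine List.ext_getElem (by simp) fun k hk hk' => ?_
    have h := key ((applyMorphism g (window x 0 n)).length + k) (n + 1) (by rw [hsucc]; omega)
    rw [window_add, applyMorphism_append, List.getElem?_append_right (by omega), window_one,
      applyMorphism_singleton, Nat.add_sub_cancel_left, zero_add, Nat.cast_id,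
      List.getElem?_eq_getElem hk'] at h
    rw [getElem_window, Option.some.inj h]
    rfl
  · have hex : ∃ n, p < (applyMorphism g (window x 0 (n + 1))).length := ⟨p, hle _⟩
    classical
    have h1 := Nat.find_spec hex
    have h2 : (applyMorphism g (window x 0 (Nat.find hex))).length ≤ p := by
      rcases Nat.eq_zero_or_pos (Nat.find hex) with h | h
      · rw [h]
        simp [window, applyMorphism]
      · have := Nat.find_min hex (Nat.sub_one_lt_of_lt h)
        rw [Nat.sub_add_cancel h] at this
        omega
    refine ⟨Nat.find hex, p - (applyMorphism g (window x 0 (Nat.find hex))).length, ?_, ?_⟩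
    · have := hsucc (Nat.find hex)
      omega
    · simp only [Nat.cast_id]
      omega

/-- The `k`-th iterate of `012/02/1` on a word. -/
def hallThueIter (k : ℕ) (u : List (Fin 3)) : List (Fin 3) :=
  (applyMorphism hallThueMorphism)^[k] u

theorem hallThueIter_succ (k : ℕ) (u : List (Fin 3)) :
    hallThueIter (k + 1) u = applyMorphism hallThueMorphism (hallThueIter k u) :=
  Function.iterate_succ_apply' _ _ _

theorem hallThueIter_add (k l : ℕ) (u : List (Fin 3)) :
    hallThueIter (k + l) u = hallThueIter k (hallThueIter l u) :=
  Function.iterate_add_apply _ _ _ _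

theorem hallThueIter_infix (k : ℕ) {u v : List (Fin 3)} (h : u <:+: v) :
    hallThueIter k u <:+: hallThueIter k v := by
  induction k with
  | zero => exact h
  | succ k ih =>
    rw [hallThueIter_succ, hallThueIter_succ]
    exact applyMorphism_infix _ ih

theorem applyMorphism_hallThueIter (k : ℕ) (u : List (Fin 3)) :
    applyMorphism (fun a => hallThueIter k [a]) u = hallThueIter k u := by
  have happ : ∀ k u v, hallThueIter k (u ++ v) = hallThueIter k u ++ hallThueIter k v := by
    intro k u v
    induction k with
    | zero => rfl
    | succ k ih => simp only [hallThueIter_succ, ih, applyMorphism_append]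
  have hnil : ∀ k, hallThueIter k [] = [] := by
    intro k
    induction k with
    | zero => rfl
    | succ k ih => rw [hallThueIter_succ, ih]; rfl
  induction u with
  | nil => rw [hnil]; rfl
  | cons a u ih =>
    rw [← List.singleton_append, applyMorphism_append, applyMorphism_singleton, ih, happ]

theorem one_le_length_hallThueMorphism : ∀ a, 1 ≤ (hallThueMorphism a).length := by decide

theorem one_le_length_g4 : ∀ a, 1 ≤ (g4 a).length := by decide

theorem hallThueIter_zero_prefix (k : ℕ) :
    hallThueIter k [0] <+: hallThueIter (k + 1) [0] := by
  induction k with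
  | zero => exact ⟨[1, 2], rfl⟩
  | succ k ih =>
    rw [hallThueIter_succ, hallThueIter_succ (k + 1)]
    exact applyMorphism_prefix _ ih

theorem hallThueIter_zero_prefix_of_le {k l : ℕ} (h : k ≤ l) :
    hallThueIter k [0] <+: hallThueIter l [0] := by
  induction l, h using Nat.le_induction with
  | base => exact List.prefix_refl _
  | succ l _ ih => exact ih.trans (hallThueIter_zero_prefix l)

theorem lt_length_hallThueIter_zero (k : ℕ) : k < (hallThueIter k [0]).length := by
  induction k with
  | zero => decide
  | succ k ih =>
    obtain ⟨t, ht⟩ : [0] <+: hallThueIter k [0] := hallThueIter_zero_prefix_of_le k.zero_le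
    rw [hallThueIter_succ, ← ht, applyMorphism_append, applyMorphism_singleton,
      List.length_append]
    rw [← ht, List.length_append] at ih
    have h1 := mul_length_le_length_applyMorphism one_le_length_hallThueMorphism t
    have h2 : (hallThueMorphism 0).length = 3 := rfl
    simp only [List.length_singleton] at ih
    omega

theorem window_hallThue_zero (k : ℕ) :
    window hallThue 0 (hallThueIter k [0]).length = hallThueIter k [0] := by
  refine List.ext_getElem (by simp) fun n hn hn' => ?_
  have h := lt_length_hallThueIter_zero n
  rw [getElem_window, zero_add, Nat.cast_id]
  change (hallThueIter n [0]).getD n 0 = _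
  rw [List.getD_eq_getElem _ _ h]
  rcases le_total n k with hk | hk
  · exact (hallThueIter_zero_prefix_of_le hk).getElem h
  · exact ((hallThueIter_zero_prefix_of_le hk).getElem hn').symm

theorem mem_factorSet_hallThue_iff {v : List (Fin 3)} :
    v ∈ factorSet hallThue ↔ ∃ k, v <:+: hallThueIter k [0] := by
  constructor
  · intro hv
    obtain ⟨i, hi⟩ := mem_factorSet_iff.1 hv
    refine ⟨i + v.length, ?_⟩
    have h1 : v <:+: window hallThue 0 (i + v.length) := by
      rw [window_add, zero_add, Nat.cast_id, hi]
      exact (List.suffix_append _ _).isInfix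
    refine h1.trans ?_
    rw [← window_hallThue_zero (i + v.length)]
    exact (window_prefix _ _ (lt_length_hallThueIter_zero _).le).isInfix
  · rintro ⟨k, hk⟩
    rw [← window_hallThue_zero] at hk
    exact mem_factorSet_of_infix (window_mem_factorSet _ _ _) hk

theorem applyInfinite_hallThue : applyInfinite hallThueMorphism hallThue = hallThue := by
  funext n
  have h1 : window hallThue 0 (n + 1) <+: hallThueIter n [0] := by
    rw [← window_hallThue_zero n]
    exact window_prefix _ _ (lt_length_hallThueIter_zero n)
  have h2 := applyMorphism_prefix hallThueMorphism h1
  rw [← hallThueIter_succ] at h2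
  have h3 : n < (applyMorphism hallThueMorphism (window hallThue 0 (n + 1))).length := by
    have := mul_length_le_length_applyMorphism one_le_length_hallThueMorphism
      (window hallThue 0 (n + 1))
    rw [length_window] at this
    omega
  have h4 := lt_length_hallThueIter_zero n
  change (applyMorphism hallThueMorphism (wordPrefix hallThue (n + 1))).getD n 0 =
    (hallThueIter n [0]).getD n 0
  rw [wordPrefix_eq_window, List.getD_eq_getElem _ _ h3, List.getD_eq_getElem _ _ h4,
    h2.getElem h3]
  exact ((hallThueIter_zero_prefix n).getElem h4).symm

/-- The starting position of the `n`-th block of the Hall–Thue word. -/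
def hallThueCut (n : ℕ) : ℕ :=
  (applyMorphism hallThueMorphism (window hallThue 0 n)).length

theorem isCoding_hallThue : IsCoding hallThueMorphism hallThue hallThue hallThueCut := by
  have h := isCoding_applyInfinite one_le_length_hallThueMorphism hallThue
  rwa [applyInfinite_hallThue] at h

/-! ### Bi-infinite words: decomposition into blocks -/

/-- A bi-infinite word is decomposed into blocks `g a` as soon as there are cut positions and every
cut position is followed, and preceded, by a block that leads to another cut position. -/
theorem exists_isCoding {α β : Type*} {g : α → List β} {w : ℤ → β} {Cut : ℤ → Prop}
    (hg : ∀ a, 1 ≤ (g a).length) (h0 : ∃ i, Cut i)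
    (hr : ∀ i, Cut i → ∃ a, window w i (g a).length = g a ∧ Cut (i + (g a).length))
    (hl : ∀ i, Cut i → ∃ a, window w (i - (g a).length) (g a).length = g a ∧
      Cut (i - (g a).length)) :
    ∃ y c, IsCoding g w y c := by
  obtain ⟨i₀, hi₀⟩ := h0
  have : Nonempty α := ⟨(hr i₀ hi₀).choose⟩
  choose! r hr1 hr2 using hr
  choose! l hl1 hl2 using hl
  let pos : ℕ → ℤ := fun n => (fun i => i + ((g (r i)).length : ℤ))^[n] i₀
  let neg : ℕ → ℤ := fun n => (fun i => i - ((g (l i)).length : ℤ))^[n] i₀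
  have pos_succ : ∀ n, pos (n + 1) = pos n + (g (r (pos n))).length := fun n =>
    Function.iterate_succ_apply' _ _ _
  have neg_succ : ∀ n, neg (n + 1) = neg n - (g (l (neg n))).length := fun n =>
    Function.iterate_succ_apply' _ _ _
  have hpos : ∀ n, Cut (pos n) := fun n => by
    induction n with
    | zero => exact hi₀
    | succ n ih => rw [pos_succ]; exact hr2 _ ih
  have hneg : ∀ n, Cut (neg n) := fun n => by
    induction n with
    | zero => exact hi₀
    | succ n ih => rw [neg_succ]; exact hl2 _ ih
  let c : ℤ → ℤ := fun n => match n with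
    | Int.ofNat n => pos n
    | Int.negSucc n => neg (n + 1)
  have hc : ∀ n, ∃ a, window w (c n) (g a).length = g a ∧ c (n + 1) = c n + (g a).length := by
    intro n
    match n with
    | Int.ofNat n => exact ⟨r (pos n), hr1 _ (hpos n), pos_succ n⟩
    | Int.negSucc 0 =>
      refine ⟨l (neg 0), ?_, ?_⟩
      · change window w (neg 1) _ = _
        rw [neg_succ]
        exact hl1 _ (hneg 0)
      · change pos 0 = neg 1 + _
        rw [neg_succ]
        change i₀ = i₀ - _ + _
        ring
    | Int.negSucc (n + 1) =>
      refine ⟨l (neg (n + 1)), ?_, ?_⟩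
      · change window w (neg (n + 1 + 1)) _ = _
        rw [neg_succ]
        exact hl1 _ (hneg _)
      · change neg (n + 1) = neg (n + 1 + 1) + _
        rw [neg_succ (n + 1)]
        ring
  choose y hy1 hy2 using hc
  have hmono : ∀ n, c n + 1 ≤ c (n + 1) := fun n => by
    have := hg (y n)
    rw [hy2]
    omega
  have hup : ∀ n : ℕ, c 0 + n ≤ c n := fun n => by
    induction n with
    | zero => simp
    | succ n ih =>
      have := hmono n
      push_cast
      omega
  have hdown : ∀ n : ℕ, c (-n) ≤ c 0 - n := fun n => by
    induction n with
    | zero => simp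
    | succ n ih =>
      have := hmono (-((n + 1 : ℕ) : ℤ))
      rw [show -((n + 1 : ℕ) : ℤ) + 1 = -(n : ℤ) by push_cast; ring] at this
      push_cast at this ⊢
      omega
  have hstrict : StrictMono c := strictMono_int_of_lt_succ fun n => by
    have := hmono n
    omega
  refine ⟨y, c, hy1, hy2, fun p => ?_⟩
  obtain ⟨n, hn1, hn2⟩ := Int.exists_greatest_of_bdd (P := fun n => c n ≤ p)
    ⟨(p - c 0).toNat, fun z hz => by
      have h1 : c z ≤ c ((p - c 0).toNat) := by
        have := hup (p - c 0).toNat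
        omega
      exact hstrict.le_iff_le.1 h1⟩
    ⟨-((c 0 - p).toNat : ℤ), by
      have := hdown (c 0 - p).toNat
      omega⟩
  have h3 : p < c (n + 1) := by
    by_contra h
    have := hn2 (n + 1) (not_lt.1 h)
    omega
  rw [hy2] at h3
  exact ⟨n, (p - c n).toNat, by omega, by omega⟩

/-! ### Square-free bi-infinite words without `010` and `212` -/

/-- The bi-infinite words that turn out to have the factors of the Hall–Thue word: those which are
square-free and avoid `010` and `212`. -/
structure IsThueWord (x : ℤ → Fin 3) : Prop where
  squarefree : ContainsOnlySquares x {v | v ∈ ([] : List (List (Fin 3)))}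
  not_010 : [0, 1, 0] ∉ factorSet x
  not_212 : [2, 1, 2] ∉ factorSet x

/-- The condition that cuts out, by `words`, the square-free words without `010` and `212`. -/
def thueOk (u : List (Fin 3)) : Bool :=
  prefixSquaresIn [] u && !([0, 1, 0].isPrefixOf u) && !([2, 1, 2].isPrefixOf u)

theorem IsThueWord.window_mem {x : ℤ → Fin 3} (hx : IsThueWord x) (i : ℤ) (n : ℕ) :
    window x i n ∈ words thueOk n := by
  refine window_mem_words (fun u hu => ?_) i n
  simp only [thueOk, Bool.and_eq_true, Bool.not_eq_true', Bool.eq_false_iff, ne_eq,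
    List.isPrefixOf_iff_prefix]
  exact ⟨⟨prefixSquaresIn_of_mem_factorSet hx.squarefree hu,
    fun h => hx.not_010 (mem_factorSet_of_infix hu h.isInfix)⟩,
    fun h => hx.not_212 (mem_factorSet_of_infix hu h.isInfix)⟩

/-- Pulling back along `g`: if `g` maps squares to squares outside `S`, and the images of `010` and
of `02120` contain squares outside `S`, then a word whose image has no squares outside `S` is
square-free and avoids `010` and `212`. In a square-free word `212` extends to `02120`. -/
theorem IsThueWord.of_isCoding {q : ℕ} {g : Fin 3 → List (Fin q)} {w : ℤ → Fin q}
    {y : ℤ → Fin 3} {c : ℤ → ℤ} (h : IsCoding g w y c) {S : List (List (Fin q))}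
    (hw : ContainsOnlySquares w {v | v ∈ S}) (hg : ∀ a, 1 ≤ (g a).length)
    (hS : ∀ u ≠ [], applyMorphism g u ++ applyMorphism g u ∉ S)
    (h1 : ∃ v ≠ [], v ++ v ∉ S ∧ v ++ v <:+: applyMorphism g [0, 1, 0])
    (h2 : ∃ v ≠ [], v ++ v ∉ S ∧ v ++ v <:+: applyMorphism g [0, 2, 1, 2, 0]) :
    IsThueWord y := by
  have bad : ∀ u, (∃ v ≠ [], v ++ v ∉ S ∧ v ++ v <:+: applyMorphism g u) →
      u ∉ factorSet y := by
    rintro u ⟨v, hv, hvS, hvu⟩ hu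
    exact hvS (hw _ (mem_factorSet_of_infix (h.applyMorphism_mem hu) hvu) ⟨v, hv, rfl⟩)
  have hsq : ContainsOnlySquares y {v | v ∈ ([] : List (List (Fin 3)))} := by
    rintro _ hu ⟨v, hv, rfl⟩
    refine absurd hu (bad _ ⟨applyMorphism g v, ?_, hS v hv, ?_⟩)
    · intro h0
      have := mul_length_le_length_applyMorphism hg v
      rw [h0, List.length_nil, one_mul, Nat.le_zero, List.length_eq_zero_iff] at this
      exact hv this
    · rw [applyMorphism_append]
  refine ⟨hsq, bad _ h1, fun hu => ?_⟩
  obtain ⟨i, hi⟩ := mem_factorSet_iff.1 hu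
  have hdec : ∀ u ∈ words (prefixSquaresIn ([] : List (List (Fin 3)))) 5,
      (u.drop 1).take 3 = [2, 1, 2] → u = [0, 2, 1, 2, 0] := by decide +kernel
  have h5 := hdec _ (window_mem_words (fun u hu => prefixSquaresIn_of_mem_factorSet hsq hu)
    (i - 1) 5) (by
      rw [take_drop_window _ _ (by norm_num)]
      simpa using hi)
  exact bad _ h2 (h5 ▸ window_mem_factorSet _ _ _)

/-- In a square-free word without `010` and `212`, every cut position is followed by a block that
ends at a cut position. The cut positions of a word over `012`, `02`, `1` are those of the letters
`0` and of the letters `1` not preceded by `0`, so the letters before and at a cut position form one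
of the words `10`, `20`, `21`. The cut position in question is the one with index `3` in `u`. -/
theorem hallThue_blocks_right : ∀ u ∈ words thueOk 7,
    (u.drop 2).take 2 ∈ [[1, 0], [2, 0], [2, 1]] →
      (∃ a, (u.drop 3).take (hallThueMorphism a).length = hallThueMorphism a ∧
        (u.drop (2 + (hallThueMorphism a).length)).take 2 ∈
          ([[1, 0], [2, 0], [2, 1]] : List (List (Fin 3)))) := by
  decide +kernel

/-- The cut position with index `5` in `u` is preceded by a block that begins at a cut position. -/
theorem hallThue_blocks_left : ∀ u ∈ words thueOk 6,
    (u.drop 4).take 2 ∈ [[1, 0], [2, 0], [2, 1]] →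
      (∃ a, (u.drop (5 - (hallThueMorphism a).length)).take (hallThueMorphism a).length =
          hallThueMorphism a ∧
        (u.drop (4 - (hallThueMorphism a).length)).take 2 ∈
          ([[1, 0], [2, 0], [2, 1]] : List (List (Fin 3)))) := by
  decide +kernel

theorem IsThueWord.exists_mem_window {x : ℤ → Fin 3} (hx : IsThueWord x) (a : Fin 3) :
    ∃ i, x i = a := by
  have hdec : ∀ u ∈ words thueOk 7, ∀ a : Fin 3, a ∈ u := by decide +kernel
  have h := hdec _ (hx.window_mem 0 7) a
  obtain ⟨k, hk, h⟩ := List.getElem_of_mem h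
  exact ⟨_, (getElem_window x 0 7 k hk).symm.trans h⟩

theorem IsThueWord.exists_hallThue_isCoding {x : ℤ → Fin 3} (hx : IsThueWord x) :
    ∃ y c, IsThueWord y ∧ IsCoding hallThueMorphism x y c := by
  have hlen : ∀ a, (hallThueMorphism a).length ≤ 3 := by decide
  have hrw : ∀ (i j : ℤ) (n a b : ℕ), a + b ≤ n → i + a = j →
      ((window x i n).drop a).take b = window x j b := fun i j n a b h h' => by
    rw [take_drop_window _ _ h, h']
  obtain ⟨y, c, h⟩ : ∃ y c, IsCoding hallThueMorphism x y c := by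
    refine exists_isCoding
      (Cut := fun i => window x (i - 1) 2 ∈ ([[1, 0], [2, 0], [2, 1]] : List (List (Fin 3))))
      one_le_length_hallThueMorphism ?_ ?_ ?_
    · obtain ⟨i, hi⟩ := hx.exists_mem_window 0
      have hdec : ∀ u ∈ words thueOk 2, (u.drop 1).take 1 = [0] →
          u ∈ ([[1, 0], [2, 0], [2, 1]] : List (List (Fin 3))) := by decide +kernel
      refine ⟨i, hdec _ (hx.window_mem _ _) ?_⟩
      rw [hrw (i - 1) i 2 1 1 (by norm_num) (by simp), window_one, hi]
    · intro i hi
      have h := hallThue_blocks_right _ (hx.window_mem (i - 3) 7)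
      rw [hrw (i - 3) (i - 1) 7 2 2 (by norm_num) (by push_cast; ring)] at h
      obtain ⟨a, ha1, ha2⟩ := h hi
      have := hlen a
      rw [hrw (i - 3) i 7 3 _ (by omega) (by push_cast; ring)] at ha1
      rw [hrw (i - 3) (i + (hallThueMorphism a).length - 1) 7 _ 2 (by omega)
        (by push_cast; ring)] at ha2
      exact ⟨a, ha1, ha2⟩
    · intro i hi
      have h := hallThue_blocks_left _ (hx.window_mem (i - 5) 6)
      rw [hrw (i - 5) (i - 1) 6 4 2 (by norm_num) (by push_cast; ring)] at h
      obtain ⟨a, ha1, ha2⟩ := h hi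
      have := hlen a
      rw [hrw (i - 5) (i - (hallThueMorphism a).length) 6 _ _ (by omega) (by omega)] at ha1
      rw [hrw (i - 5) (i - (hallThueMorphism a).length - 1) 6 _ 2 (by omega) (by omega)] at ha2
      exact ⟨a, ha1, ha2⟩
  exact ⟨y, c, .of_isCoding h hx.squarefree one_le_length_hallThueMorphism (by simp)
    ⟨[2, 0], by decide, by decide, by decide⟩ ⟨[2, 1, 0], by decide, by decide, by decide⟩, h⟩

theorem IsThueWord.exists_iter_isCoding {x : ℤ → Fin 3} (hx : IsThueWord x) (k : ℕ) :
    ∃ y c, IsThueWord y ∧ IsCoding (fun a => hallThueIter k [a]) x y c := by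
  induction k with
  | zero =>
    refine ⟨x, id, hx, fun n => window_one x n, fun n => by simp [hallThueIter],
      fun p => ⟨p, 0, by simp [hallThueIter], by simp⟩⟩
  | succ k ih =>
    obtain ⟨y, c, hy, h⟩ := ih
    obtain ⟨z, d, hz, h'⟩ := hy.exists_hallThue_isCoding
    refine ⟨z, fun n => c (d n), hz, ?_⟩
    have hcomp := h.comp h'
    have heq : (fun a => applyMorphism (fun a => hallThueIter k [a]) (hallThueMorphism a)) =
        fun a => hallThueIter (k + 1) [a] := by
      funext a
      rw [applyMorphism_hallThueIter, hallThueIter_add, hallThueIter_succ 0]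
      congr 1
      simp [hallThueIter]
    rwa [heq] at hcomp

theorem le_length_hallThueIter (n : ℕ) (a : Fin 3) :
    n ≤ (hallThueIter (n + 1 + 1) [a]).length := by
  have h : ∀ a : Fin 3, [0] <:+: hallThueIter 2 [a] := by decide
  have h1 := (hallThueIter_infix n (h a)).length_le
  rw [← hallThueIter_add] at h1
  exact (lt_length_hallThueIter_zero n).le.trans h1

theorem IsThueWord.factorSet_eq {x : ℤ → Fin 3} (hx : IsThueWord x) :
    factorSet x = factorSet hallThue := by
  ext v
  rw [mem_factorSet_hallThue_iff]
  constructor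
  · intro hv
    obtain ⟨p, hp⟩ := mem_factorSet_iff.1 hv
    obtain ⟨y, c, hy, h⟩ := hx.exists_iter_isCoding (v.length + 1 + 1)
    obtain ⟨m, hm⟩ := h.exists_window_infix (le_length_hallThueIter v.length)
      (k := 1) (mul_one _).ge p
    rw [hp, applyMorphism_hallThueIter] at hm
    have hdec : ∀ u ∈ words thueOk 2, u <:+: hallThueIter 4 [0] := by decide +kernel
    refine ⟨v.length + 1 + 1 + 4, hm.trans ?_⟩
    rw [hallThueIter_add _ 4]
    exact hallThueIter_infix _ (hdec _ (hy.window_mem m 2))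
  · rintro ⟨k, hk⟩
    obtain ⟨y, c, hy, h⟩ := hx.exists_iter_isCoding k
    obtain ⟨i, hi⟩ := hy.exists_mem_window 0
    have h0 := h.applyMorphism_mem (window_mem_factorSet y i 1)
    rw [window_one, hi, applyMorphism_singleton] at h0
    exact mem_factorSet_of_infix h0 hk

/-! ### Bi-infinite binary words with four squares -/

/-- The squares `00`, `11`, `001001`, `110110`, as a list. -/
def fourSquareList : List (List (Fin 2)) :=
  [[0, 0], [1, 1], [0, 0, 1, 0, 0, 1], [1, 1, 0, 1, 1, 0]]

theorem fourSquares_eq : fourSquares = {v | v ∈ fourSquareList} := by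
  ext v
  simp [fourSquares, fourSquareList]

/-- The contexts, consisting of four letters before and two letters after it, in which the start of
a block `g4 a` can occur. -/
def g4CutContexts : List (List (Fin 2)) :=
  [[1, 0, 1, 1, 0, 0], [0, 1, 1, 1, 0, 0]]

/-- A word of length `22` with only the four squares contains a cut position. -/
theorem words_without_g4Cut :
    words (fun u => prefixSquaresIn fourSquareList u && !g4CutContexts.contains (u.take 6)) 22 =
      [] := by
  decide +kernel

/-- In a binary word with only the four squares, every cut position is followed by a block that
ends at a cut position. The reversed words `u` consist of `8` letters before the cut position and
`21` letters after it. -/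
theorem g4_blocks_right :
    ∀ u ∈ extend (prefixSquaresIn (fourSquareList.map List.reverse))
        ((words (prefixSquaresIn (fourSquareList.map List.reverse)) 10).filter
          fun u => g4CutContexts.contains (u.reverse.drop 4)) 19,
      ∃ a, (u.reverse.drop 8).take (g4 a).length = g4 a ∧
        (u.reverse.drop (4 + (g4 a).length)).take 6 ∈ g4CutContexts := by
  decide +kernel

/-- In a binary word with only the four squares, every cut position is preceded by a block that
begins at a cut position. The words `u` consist of `21` letters before the cut position and `10`
letters after it. -/
theorem g4_blocks_left :
    ∀ u ∈ extend (prefixSquaresIn fourSquareList)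
        ((words (prefixSquaresIn fourSquareList) 14).filter
          fun u => g4CutContexts.contains (u.take 6)) 17,
      ∃ a, (u.drop (21 - (g4 a).length)).take (g4 a).length = g4 a ∧
        (u.drop (17 - (g4 a).length)).take 6 ∈ g4CutContexts := by
  decide +kernel

theorem exists_g4_isCoding {w : ℤ → Fin 2} (hw : ContainsOnlySquares w fourSquares) :
    ∃ y c, IsThueWord y ∧ IsCoding g4 w y c := by
  rw [fourSquares_eq] at hw
  have hok := fun u hu => prefixSquaresIn_of_mem_factorSet (u := u) hw hu
  have hok' := fun u hu => prefixSquaresIn_reverse_of_mem_factorSet (u := u) hw hu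
  have hlen : ∀ a, (g4 a).length ≤ 17 := by decide
  have hrw : ∀ (i j : ℤ) (n a b : ℕ), a + b ≤ n → i + a = j →
      ((window w i n).drop a).take b = window w j b := fun i j n a b h h' => by
    rw [take_drop_window _ _ h, h']
  obtain ⟨y, c, h⟩ : ∃ y c, IsCoding g4 w y c := by
    refine exists_isCoding (Cut := fun i => window w (i - 4) 6 ∈ g4CutContexts)
      one_le_length_g4 ?_ ?_ ?_
    · by_contra! hno
      suffices h : window w 0 22 ∈ words (fun u => prefixSquaresIn fourSquareList u &&
          !g4CutContexts.contains (u.take 6)) 22 by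
        rw [words_without_g4Cut] at h
        exact List.not_mem_nil h
      refine window_mem_words (fun u hu => ?_) 0 22
      simp only [Bool.and_eq_true, Bool.not_eq_true', Bool.eq_false_iff, ne_eq,
        List.contains_iff_mem]
      refine ⟨hok u hu, fun hmem => ?_⟩
      have hlen6 : ∀ v ∈ g4CutContexts, v.length = 6 := by decide
      obtain ⟨i, hi⟩ :=
        mem_factorSet_iff.1 (mem_factorSet_of_infix hu (List.take_prefix 6 u).isInfix)
      rw [hlen6 _ hmem] at hi
      refine hno (i + 4) ?_
      rwa [add_sub_cancel_right, hi]
    · intro i hi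
      have h10 : (window w (i - 8) 10).reverse ∈
          (words (prefixSquaresIn (fourSquareList.map List.reverse)) 10).filter
            fun u => g4CutContexts.contains (u.reverse.drop 4) := by
        rw [List.mem_filter, List.contains_iff_mem, List.reverse_reverse,
          ← List.take_of_length_le (l := (window w (i - 8) 10).drop 4) (i := 6) (by simp),
          hrw (i - 8) (i - 4) 10 4 6 (by norm_num) (by push_cast; ring)]
        exact ⟨reverse_window_mem_words hok' _ _, hi⟩
      obtain ⟨a, ha1, ha2⟩ := g4_blocks_right _ (reverse_window_mem_extend hok' h10 19)
      have := hlen a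
      rw [List.reverse_reverse] at ha1 ha2
      rw [hrw (i - 8) i 29 8 _ (by omega) (by push_cast; ring)] at ha1
      rw [hrw (i - 8) (i + (g4 a).length - 4) 29 _ 6 (by omega) (by push_cast; ring)] at ha2
      exact ⟨a, ha1, ha2⟩
    · intro i hi
      have h14 : window w (i - 4) 14 ∈ (words (prefixSquaresIn fourSquareList) 14).filter
          fun u => g4CutContexts.contains (u.take 6) := by
        rw [List.mem_filter, List.contains_iff_mem, ← List.drop_zero (l := window w (i - 4) 14),
          hrw (i - 4) (i - 4) 14 0 6 (by norm_num) (by simp), List.drop_zero]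
        exact ⟨window_mem_words hok _ _, hi⟩
      obtain ⟨a, ha1, ha2⟩ := g4_blocks_left _
        (window_mem_extend hok (n := 17) (i := i - 21) (by push_cast; ring) h14)
      have := hlen a
      rw [hrw (i - 21) (i - (g4 a).length) 31 _ _ (by omega) (by omega)] at ha1
      rw [hrw (i - 21) (i - (g4 a).length - 4) 31 _ 6 (by omega) (by omega)] at ha2
      exact ⟨a, ha1, ha2⟩
  have hbig : ∀ u ≠ [], applyMorphism g4 u ++ applyMorphism g4 u ∉ fourSquareList := by
    intro u hu hmem
    have h1 := mul_length_le_length_applyMorphism (g := g4) (L := 5) (by decide) u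
    have h2 : ∀ v ∈ fourSquareList, v.length ≤ 6 := by decide
    have h3 := h2 _ hmem
    have h4 := List.length_pos_of_ne_nil hu
    rw [List.length_append] at h3
    omega
  -- The square in the image of `010` has period `|g4 1|`, that in the image of `02120` has
  -- period `|g4 2| + |g4 1|`.
  exact ⟨y, c, .of_isCoding h hw one_le_length_g4 hbig
    ⟨[0, 0, 1, 1, 1, 0, 1, 1, 0, 0, 0, 1], by decide, by decide, by decide +kernel⟩
    ⟨[0, 0, 1, 1, 1, 0, 1, 1, 0, 0, 1, 1, 1, 0, 0, 0, 1], by decide, by decide,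
      by decide +kernel⟩, h⟩

/-! ### Squares in the image of an infinite word -/

/-- Data that control how far a repetition in an image under `g` extends beyond the blocks that
repeat: the blocks of `a ≠ b` differ in the letter with index `δ a b`, counted from the left as well
as from the right. By `eq_of_le`, a block is longer than the sum of what can be matched of it from
both sides, unless it is the block of `1`, and both neighbouring blocks are those of `0`. -/
structure IsSynchronizing {β : Type*} (g : Fin 3 → List β) (δ : Fin 3 → Fin 3 → ℕ) : Prop where
  lt_left : ∀ a b, a ≠ b → δ a b < (g a).length
  lt_right : ∀ a b, a ≠ b → δ a b < (g b).length
  ne : ∀ a b, a ≠ b → (g a)[δ a b]? ≠ (g b)[δ a b]?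
  reverse_ne : ∀ a b, a ≠ b →
    (g a)[(g a).length - 1 - δ a b]? ≠ (g b)[(g b).length - 1 - δ a b]?
  eq_of_le : ∀ a b c, a ≠ b → b ≠ c → (g b).length ≤ δ b c + δ a b → a = 0 ∧ b = 1 ∧ c = 0

/-- Suppose that the image of `y` has, at position `p`, a square of period `n`, and that some
position `c m` in the first half of it is a block boundary together with `c m + n = c (m + r)`.
Extend the repetition `y j = y (j + r)` around `m` as far as possible, to the `j` with
`m₁ ≤ j < m₂`. If this falls short of a square, then `m₂ + 1 = m₁ + r`, and the letters with indices
`m₁ - 1`, `m₂`, `m₂ + r` are `0`, `1`, `0`: so `y` has a factor `0u1u0`, and thus `010` or `212`. -/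
theorem exists_square_of_synchronized {β : Type*} {g : Fin 3 → List β} {δ : Fin 3 → Fin 3 → ℕ}
    (hg : IsSynchronizing g δ) {w : ℕ → β} {y : ℕ → Fin 3} {c : ℕ → ℕ} (h : IsCoding g w y c)
    (hy : ∀ i, y i ≠ y (i + 1)) (h010 : ∀ i, ¬(y i = 0 ∧ y (i + 1) = 1 ∧ y (i + 2) = 0))
    (h212 : ∀ i, ¬(y i = 2 ∧ y (i + 1) = 1 ∧ y (i + 2) = 2)) {p n m r : ℕ} (hr : 0 < r)
    (hper : ∀ i, p ≤ i → i < p + n → w i = w (i + n)) (hpm : p ≤ c m) (hmp : c m ≤ p + n)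
    (hmr : c (m + r) = c m + n) : ∃ s, ∀ j < r, y (s + j) = y (s + j + r) := by
  by_contra! hsq
  have hsucc : ∀ j, c (j + 1) = c j + (g (y j)).length := fun j => h.succ j
  have hw : ∀ j s, s < (g (y j)).length → (g (y j))[s]? = some (w (c j + s)) := fun j s hs => by
    have := getElem?_window w (c j) hs
    rwa [h.block] at this
  have hmono : Monotone c := monotone_nat_of_le_succ fun j => by rw [hsucc]; omega
  -- the first index from `m` on at which the repetition in `y` breaks
  obtain ⟨m₂, hm₂, hne₂, heq₂⟩ : ∃ m₂, m ≤ m₂ ∧ y m₂ ≠ y (m₂ + r) ∧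
      ∀ j, m ≤ j → j < m₂ → y j = y (j + r) := by
    classical
    have hex : ∃ k, y (m + k) ≠ y (m + k + r) := by
      obtain ⟨k, -, hk⟩ := hsq m
      exact ⟨k, hk⟩
    refine ⟨m + Nat.find hex, by omega, Nat.find_spec hex, fun j hj hj' => ?_⟩
    have := Nat.find_min hex (m := j - m) (by omega)
    rw [Nat.add_sub_cancel' hj] at this
    exact not_not.1 this
  -- the first index from which the repetition lasts until `m`
  obtain ⟨m₁, hm₁, heq₁, hne₁⟩ : ∃ m₁, m₁ ≤ m ∧ (∀ j, m₁ ≤ j → j < m → y j = y (j + r)) ∧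
      ∀ k, m₁ = k + 1 → y k ≠ y (k + r) := by
    classical
    have hex : ∃ m₁, m₁ ≤ m ∧ ∀ j, m₁ ≤ j → j < m → y j = y (j + r) :=
      ⟨m, le_rfl, fun j h1 h2 => absurd h1 (by omega)⟩
    refine ⟨Nat.find hex, (Nat.find_spec hex).1, (Nat.find_spec hex).2, fun k hk heq => ?_⟩
    refine Nat.find_min hex (m := k) (by omega) ⟨by have := (Nat.find_spec hex).1; omega, ?_⟩
    intro j hj hj'
    rcases hj.eq_or_lt with rfl | hlt
    · exact heq
    · exact (Nat.find_spec hex).2 j (by omega) hj'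
  have heq : ∀ j, m₁ ≤ j → j < m₂ → y j = y (j + r) := fun j h1 h2 => by
    rcases lt_or_ge j m with h | h
    · exact heq₁ j h1 h
    · exact heq₂ j h h2
  have hlt : m₂ < m₁ + r := by
    obtain ⟨j, hj, hne⟩ := hsq m₁
    by_contra hle
    exact hne (heq _ (by omega) (by omega))
  have hc : ∀ j, m₁ ≤ j → j < m₂ → (c (j + r) = c j + n ↔ c (j + 1 + r) = c (j + 1) + n) := by
    intro j h1 h2
    rw [add_right_comm, hsucc, hsucc, ← heq j h1 h2]
    omega
  have hc₂ : ∀ k, m + k ≤ m₂ → c (m + k + r) = c (m + k) + n := fun k => by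
    induction k with
    | zero => exact fun _ => hmr
    | succ k ih => exact fun hk => (hc (m + k) (by omega) (by omega)).1 (ih (by omega))
  have hc₁ : ∀ k, m₁ + k ≤ m → c (m - k + r) = c (m - k) + n := fun k => by
    induction k with
    | zero => exact fun _ => hmr
    | succ k ih =>
      intro hk
      refine (hc (m - (k + 1)) (by omega) (by omega)).2 ?_
      rw [show m - (k + 1) + 1 = m - k by omega]
      exact ih (by omega)
  have hcm₂ := hc₂ (m₂ - m) (by omega)
  rw [Nat.add_sub_cancel' hm₂] at hcm₂
  have hcm₁ := hc₁ (m - m₁) (by omega)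
  rw [Nat.sub_sub_self hm₁] at hcm₁
  have hmono₂ := hmono hm₂
  have hmono₁ := hmono hm₁
  -- The match of the blocks with indices `m₂` and `m₂ + r` stops within `δ` letters.
  have hright : p + n ≤ c m₂ + δ (y m₂) (y (m₂ + r)) := by
    by_contra hlt'
    refine hg.ne _ _ hne₂ ?_
    rw [hw _ _ (hg.lt_left _ _ hne₂), hw _ _ (hg.lt_right _ _ hne₂), hcm₂,
      hper _ (by omega) (by omega), add_right_comm]
  have hpos : c m₂ + (g (y m₂)).length ≤ c (m₁ + r) := by
    rw [← hsucc]
    exact hmono (by omega)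
  have hlt₂ := hg.lt_left _ _ hne₂
  obtain rfl | ⟨k, rfl⟩ : m₁ = 0 ∨ ∃ k, m₁ = k + 1 := by
    rcases m₁ with _ | k
    · exact .inl rfl
    · exact .inr ⟨k, rfl⟩
  · obtain ⟨j, d, -, hp⟩ := h.cover p
    have := hmono j.zero_le
    simp only [Nat.cast_id] at hp
    omega
  have hne := hne₁ k rfl
  have hlt_l := hg.lt_left _ _ hne
  have hlt_r := hg.lt_right _ _ hne
  have hk := hsucc k
  have hkr := hsucc (k + r)
  rw [add_right_comm] at hkr
  have hleft : c (k + 1) ≤ p + δ (y k) (y (k + r)) := by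
    by_contra hlt'
    refine hg.reverse_ne _ _ hne ?_
    rw [hw _ _ (by omega), hw _ _ (by omega), hper _ (by omega) (by omega)]
    congr 2
    omega
  have hm₂r : m₂ = k + r := by
    by_contra hne'
    have h1 := hmono (show m₂ + 1 ≤ k + r by omega)
    rw [hsucc] at h1
    omega
  subst hm₂r
  obtain ⟨h0, h1, h2⟩ := hg.eq_of_le _ _ _ hne hne₂ (by omega)
  -- Thus `y` has the factor `0u1u0` at `k`, where `u` has length `r - 1`.
  obtain rfl | hr1 : r = 1 ∨ 1 < r := by omega
  · exact h010 k ⟨h0, h1, h2⟩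
  · have three : ∀ a : Fin 3, a ≠ 0 → a ≠ 1 → a = 2 := by decide
    have hfirst := heq (k + 1) le_rfl (by omega)
    have hlast := heq (k + r - 1) (by omega) (by omega)
    have e1 : y (k + 1 + r) = 2 := three _ (fun hh => hy k (h0.trans (hfirst.trans hh).symm))
      (fun hh => hy (k + r) (by rw [h1, ← hh, add_right_comm]))
    have e2 : y (k + r - 1) = 2 := by
      refine three _ (fun hh => hy (k + r + r - 1) ?_) (fun hh => hy (k + r - 1) ?_)
      · rw [show k + r + r - 1 + 1 = k + r + r by omega, h2, ← hh, hlast]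
        congr 1
        omega
      · rw [hh, show k + r - 1 + 1 = k + r by omega, h1]
    refine h212 (k + r - 1) ⟨e2, ?_, ?_⟩
    · rw [show k + r - 1 + 1 = k + r by omega, h1]
    · rw [show k + r - 1 + 2 = k + 1 + r by omega, e1]

/-- The factors of length `7` of the Hall–Thue word. -/
def hallThueFactors : List (List (Fin 3)) :=
  ((List.range 40).map fun k => ((hallThueIter 6 [0]).drop k).take 7).dedup

theorem window_hallThue_mem (p : ℕ) : window hallThue p 7 ∈ hallThueFactors := by
  have hstep : ∀ u ∈ hallThueFactors, ∀ d < (hallThueMorphism (u.getD 0 0)).length,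
      d + 7 ≤ (applyMorphism hallThueMorphism u).length ∧
      ((applyMorphism hallThueMorphism u).drop d).take 7 ∈ hallThueFactors := by
    decide +kernel
  induction p using Nat.strong_induction_on with
  | _ p ih =>
    rcases Nat.eq_zero_or_pos p with rfl | hp
    · have hdec : (hallThueIter 3 [0]).take 7 ∈ hallThueFactors := by decide +kernel
      rw [← window_hallThue_zero 3, ← List.drop_zero (l := window hallThue 0 _),
        take_drop_window _ _ (by decide)] at hdec
      exact hdec
    · obtain ⟨m, d, hd, hp'⟩ := isCoding_hallThue.cover p
      have hlt : m < p := by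
        have h0 : hallThueCut 0 = 0 := rfl
        have h1 : hallThueCut 1 = 3 := rfl
        have hmono : ∀ m, m + 3 ≤ hallThueCut (m + 1) := fun m => by
          induction m with
          | zero => exact h1.ge
          | succ m ih' =>
            have h2 := isCoding_hallThue.succ (m + 1)
            have h3 := one_le_length_hallThueMorphism (hallThue (m + 1))
            simp only [Nat.cast_id] at h2
            omega
        simp only [Nat.cast_id] at hp'
        rcases m with _ | m
        · exact hp
        · have := hmono m
          omega
      have hgetD : (window hallThue m 7).getD 0 0 = hallThue m := rfl
      obtain ⟨h1, h2⟩ := hstep _ (ih m hlt) d (by rwa [hgetD])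
      rw [hp', isCoding_hallThue.window_eq m h1]
      exact h2

theorem hallThue_getElem?_eq (p : ℕ) {k : ℕ} (hk : k < 7) :
    (window hallThue p 7)[k]? = some (hallThue (p + k)) :=
  getElem?_window _ _ hk

theorem hallThue_ne_succ (i : ℕ) : hallThue i ≠ hallThue (i + 1) := by
  have hdec : ∀ u ∈ hallThueFactors, u[0]? ≠ u[1]? := by decide +kernel
  have h := hdec _ (window_hallThue_mem i)
  rw [hallThue_getElem?_eq _ (by norm_num), hallThue_getElem?_eq _ (by norm_num)] at h
  exact fun h' => h (congrArg some h')

theorem hallThue_not_010 (i : ℕ) :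
    ¬(hallThue i = 0 ∧ hallThue (i + 1) = 1 ∧ hallThue (i + 2) = 0) := by
  have hdec : ∀ u ∈ hallThueFactors,
      ¬(u[0]? = some 0 ∧ u[1]? = some 1 ∧ u[2]? = some 0) := by decide +kernel
  have h := hdec _ (window_hallThue_mem i)
  simpa only [hallThue_getElem?_eq i (show 0 < 7 by norm_num),
    hallThue_getElem?_eq i (show 1 < 7 by norm_num),
    hallThue_getElem?_eq i (show 2 < 7 by norm_num), Option.some.injEq, add_zero] using h

theorem hallThue_not_212 (i : ℕ) :
    ¬(hallThue i = 2 ∧ hallThue (i + 1) = 1 ∧ hallThue (i + 2) = 2) := by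
  have hdec : ∀ u ∈ hallThueFactors,
      ¬(u[0]? = some 2 ∧ u[1]? = some 1 ∧ u[2]? = some 2) := by decide +kernel
  have h := hdec _ (window_hallThue_mem i)
  simpa only [hallThue_getElem?_eq i (show 0 < 7 by norm_num),
    hallThue_getElem?_eq i (show 1 < 7 by norm_num),
    hallThue_getElem?_eq i (show 2 < 7 by norm_num), Option.some.injEq, add_zero] using h

/-- The finite verification for the squares in the image of the Hall–Thue word under `g`: the word
`μ` occurs only at block boundaries, it occurs in every factor of length `N`, and the squares of
period less than `N` belong to `S`. Every position lies in the first block of the image of a factor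
of length `7`, which contains the `2 * N` letters that follow. -/
structure IsMarked {β : Type*} [DecidableEq β] (g : Fin 3 → List β) (μ : List β) (N : ℕ)
    (S : List (List β)) : Prop where
  length_le : ∀ u ∈ hallThueFactors,
    (g (u.getD 0 0)).length + 2 * N ≤ (applyMorphism g u).length
  marker : ∀ u ∈ hallThueFactors, ∀ d < (g (u.getD 0 0)).length,
    ((applyMorphism g u).drop d).take μ.length = μ → d = 0
  exists_marker : ∀ u ∈ hallThueFactors, ∀ d < (g (u.getD 0 0)).length, ∃ o < N,
    o + μ.length ≤ N ∧ ((applyMorphism g u).drop (d + o)).take μ.length = μ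
  squares : ∀ u ∈ hallThueFactors, ∀ d < (g (u.getD 0 0)).length, ∀ n < N,
    ((applyMorphism g u).drop d).take n = ((applyMorphism g u).drop (d + n)).take n →
      n = 0 ∨ ((applyMorphism g u).drop d).take (n + n) ∈ S

/-- A square in an image of the Hall–Thue word either is one of the squares in `S`, or forces a
square in the Hall–Thue word itself. In the second case a marker occurs in both halves. -/
theorem IsCoding.mem_or_exists_square {β : Type*} [DecidableEq β] {g : Fin 3 → List β}
    {μ : List β} {N : ℕ} {S : List (List β)} {δ : Fin 3 → Fin 3 → ℕ} {w : ℕ → β} {c : ℕ → ℕ}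
    (h : IsCoding g w hallThue c) (hg : IsSynchronizing g δ) (hm : IsMarked g μ N S) {p n : ℕ} (hn : 0 < n)
    (hsq : window w p n = window w (p + n) n) :
    window w p (n + n) ∈ S ∨ ∃ m r, 0 < r ∧ c (m + r) = c m + n ∧
      window w (c m) μ.length = μ ∧
      ∃ s, ∀ j < r, hallThue (s + j) = hallThue (s + j + r) := by
  have hsucc : ∀ j, c (j + 1) = c j + (g (hallThue j)).length := fun j => h.succ j
  have hmono : Monotone c := monotone_nat_of_le_succ fun j => by rw [hsucc]; omega
  have hgetD : ∀ m, (window hallThue m 7).getD 0 0 = hallThue m := fun m => rfl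
  obtain ⟨m, d, hd, hp⟩ := h.cover p
  rw [Nat.cast_id] at hp
  have hlen := hm.length_le _ (window_hallThue_mem m)
  obtain ⟨o, hoN, ho, hoμ⟩ := hm.exists_marker _ (window_hallThue_mem m) d (by rwa [hgetD])
  rw [hgetD] at hlen
  have hmarker : ∀ i, window w i μ.length = μ → ∃ m, i = c m := fun i hi => by
    obtain ⟨m', d', hd', hi'⟩ := h.cover i
    have hlen' := hm.length_le _ (window_hallThue_mem m')
    rw [hgetD] at hlen'
    rw [hi', h.window_eq m' (k := 7) (by omega)] at hi
    have := hm.marker _ (window_hallThue_mem m') d' (by rwa [hgetD]) hi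
    exact ⟨m', by simpa [this] using hi'⟩
  rcases lt_or_ge n N with hnN | hnN
  · left
    have e1 := h.window_eq m (k := 7) (d := d) (n := n) (by omega)
    have e2 := h.window_eq m (k := 7) (d := d + n) (n := n) (by omega)
    have e3 := h.window_eq m (k := 7) (d := d) (n := n + n) (by omega)
    rw [Nat.cast_id, ← hp] at e1 e3
    rw [Nat.cast_id, ← add_assoc, ← hp] at e2
    rw [e1, e2] at hsq
    rw [e3]
    exact (hm.squares _ (window_hallThue_mem m) d (by rwa [hgetD]) n hnN hsq).resolve_left hn.ne'
  · right
    have hper : ∀ i, p ≤ i → i < p + n → w i = w (i + n) := fun i h1 h2 => by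
      have e1 := getElem?_window w p (k := i - p) (n := n) (by omega)
      have e2 := getElem?_window w (p + n) (k := i - p) (n := n) (by omega)
      rw [hsq, e2, Option.some.injEq] at e1
      simp only [Nat.cast_id] at e1
      rw [show p + n + (i - p) = i + n by omega, show p + (i - p) = i by omega] at e1
      exact e1.symm
    have hfirst : window w (p + o) μ.length = μ := by
      rw [← h.window_eq m (k := 7) (by omega), Nat.cast_id, ← add_assoc, ← hp] at hoμ
      exact hoμ
    have hsecond : window w (p + o + n) μ.length = μ := by
      rw [← hfirst, length_window]
      refine List.ext_getElem (by simp) fun k hk _ => ?_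
      rw [length_window] at hk
      simp only [getElem_window, Nat.cast_id]
      rw [hper (p + o + k) (by omega) (by omega)]
      congr 1
      omega
    obtain ⟨a, ha⟩ := hmarker _ hfirst
    obtain ⟨b, hb⟩ := hmarker _ hsecond
    have hab : a < b := by
      by_contra hle
      have := hmono (not_lt.1 hle)
      omega
    obtain ⟨r, rfl⟩ := Nat.exists_eq_add_of_lt hab
    have hc : c (a + (r + 1)) = c a + n := by rw [← ha, hb]; rfl
    refine ⟨a, r + 1, r.succ_pos, hc, ha ▸ hfirst, ?_⟩
    exact exists_square_of_synchronized hg h hallThue_ne_succ hallThue_not_010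
      hallThue_not_212 r.succ_pos hper (by omega) (by omega) hc

theorem isSynchronizing_hallThueMorphism :
    IsSynchronizing hallThueMorphism ![![0, 1, 0], ![1, 0, 0], ![0, 0, 0]] := by
  constructor <;> decide

theorem isSynchronizing_g4 :
    IsSynchronizing g4 ![![0, 8, 2], ![8, 0, 2], ![2, 2, 0]] := by
  constructor <;> decide

theorem isMarked_hallThueMorphism : IsMarked hallThueMorphism [0] 4 [] := by
  constructor <;> decide +kernel

theorem isMarked_g4 : IsMarked g4 [0, 0, 0, 1, 0] 26 fourSquareList := by
  constructor <;> decide +kernel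

/-- The Hall–Thue word is square-free: a square of period `n` leads to one of smaller period. -/
theorem window_hallThue_ne {n : ℕ} (hn : 0 < n) (p : ℕ) :
    window hallThue p n ≠ window hallThue (p + n) n := by
  induction n using Nat.strong_induction_on generalizing p with
  | _ n ih =>
    intro hsq
    have hmem := isCoding_hallThue.mem_or_exists_square isSynchronizing_hallThueMorphism
      isMarked_hallThueMorphism hn hsq
    obtain ⟨m, r, hr, hc, hmark, s, hs⟩ := hmem.resolve_left List.not_mem_nil
    -- The block at the marker is not that of `2`, so it has more than one letter and `r < n`.
    have hblock : 2 ≤ (hallThueMorphism (hallThue m)).length := by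
      have hdec : ∀ a, (hallThueMorphism a)[0]? = some 0 → 2 ≤ (hallThueMorphism a).length := by
        decide
      refine hdec _ ?_
      rw [← isCoding_hallThue.block m, getElem?_window _ _ (one_le_length_hallThueMorphism _)]
      rw [List.length_singleton, window_one, List.singleton_inj] at hmark
      simpa using hmark
    have hadd : ∀ k, hallThueCut m + 2 + k ≤ hallThueCut (m + (k + 1)) := fun k => by
      induction k with
      | zero =>
        have := isCoding_hallThue.succ m
        simp only [Nat.cast_id] at this
        rw [zero_add, this]
        omega
      | succ k ih' =>
        have h1 := isCoding_hallThue.succ (m + (k + 1))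
        have h2 := one_le_length_hallThueMorphism (hallThue (m + (k + 1)))
        simp only [Nat.cast_id] at h1
        rw [← add_assoc m (k + 1) 1, h1]
        omega
    have hrn : r < n := by
      have := hadd (r - 1)
      rw [Nat.sub_add_cancel hr] at this
      omega
    refine ih r hrn hr s (List.ext_getElem (by simp) fun j hj _ => ?_)
    rw [length_window] at hj
    simp only [getElem_window, Nat.cast_id]
    rw [hs j hj, add_right_comm]

theorem containsOnlySquares_g4_hallThue :
    ContainsOnlySquares (applyInfinite g4 hallThue) fourSquares := by
  rintro _ hu ⟨v, hv, rfl⟩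
  obtain ⟨p, hp⟩ := mem_factorSet_iff.1 hu
  rw [List.length_append] at hp
  have hsplit := hp
  rw [window_add] at hsplit
  obtain ⟨h1, h2⟩ := List.append_inj hsplit (by simp)
  have h := isCoding_applyInfinite one_le_length_g4 hallThue
  rw [fourSquares_eq]
  rcases h.mem_or_exists_square isSynchronizing_g4 isMarked_g4
    (List.length_pos_of_ne_nil hv) (h1.trans h2.symm) with hmem | ⟨m, r, hr, -, -, s, hs⟩
  · rwa [hp] at hmem
  · refine absurd (List.ext_getElem (by simp) fun j hj _ => ?_) (window_hallThue_ne hr s)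
    rw [length_window] at hj
    simp only [getElem_window, Nat.cast_id]
    rw [hs j hj, add_right_comm]

end FourSquares

theorem mainTheorem1 :
    (∀ w : ℤ → Fin 2,
      FourSquares.ContainsOnlySquares w FourSquares.fourSquares →
        FourSquares.factorSet w =
          FourSquares.factorSet (FourSquares.applyInfinite FourSquares.g4 FourSquares.hallThue)) ∧
    FourSquares.ContainsOnlySquares
      (FourSquares.applyInfinite FourSquares.g4 FourSquares.hallThue)
      FourSquares.fourSquares := by
  refine ⟨fun w hw => ?_, FourSquares.containsOnlySquares_g4_hallThue⟩
  obtain ⟨y, c, hy, h⟩ := FourSquares.exists_g4_isCoding hw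
  have h' := FourSquares.isCoding_applyInfinite FourSquares.one_le_length_g4 FourSquares.hallThue
  ext v
  rw [h.mem_factorSet_iff FourSquares.one_le_length_g4,
    h'.mem_factorSet_iff FourSquares.one_le_length_g4, hy.factorSet_eq]
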